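/- Vectors $v_1,\dots,v_m\in\mathbb{Z}^n$ are called Farkas-related if for all integers $a_1\le b_1,\dots,a_m\le b_m$ the following holds: whenever a vector $w\in\sum_{i=1}^m\mathbb{Z}v_i$ can be written as $w=\sum_{i=1}^m x_iv_i$ with rational numbers $a_i\le x_i\le b_i$ ($i=1,\dots,m$), it can also be written as $w=\sum_{i=1}^m y_iv_i$ with integers $a_i\le y_i\le b_i$ ($i=1,\dots,m$). An integral matrix is called a Farkas matrix if its columns are Farkas-related. The (unsigned) incidence matrix of a finite simple graph $G$ with vertices $1,\dots,n$ and edges $e_1,\dots,e_m$ is the $n\times m$ matrix $M$ with $M_{ij}=1$ if the vertex $i$ is an end of the edge $e_j$, and $M_{ij}=0$ otherwise. **Proposition.** The incidence matrix of a finite simple graph $G$ is a Farkas matrix if and only if $G$ does not contain two vertex-disjoint cycles of odd length that are connected by a path in $G$ (a path from a vertex of one cycle to a vertex of the other). -/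

import Mathlib

/-- Integral vectors `v i` (`i : ι`, a finite family) are Farkas-related: for all integer bounds
`a i ≤ b i`, every `w` in the `ℤ`-span of the family that is a combination of the `v i` with
rational coefficients in the intervals `[a i, b i]` is a combination of the `v i` with integer
coefficients in the same intervals. -/
def FarkasRelated {ι κ : Type*} [Fintype ι] (v : ι → κ → ℤ) : Prop :=
  ∀ a b : ι → ℤ, (∀ i, a i ≤ b i) →
    ∀ w ∈ Submodule.span ℤ (Set.range v),
      (∃ x : ι → ℚ, (∀ i, (a i : ℚ) ≤ x i ∧ x i ≤ (b i : ℚ)) ∧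
        ∀ k, (w k : ℚ) = ∑ i, x i * (v i k : ℚ)) →
      ∃ y : ι → ℤ, (∀ i, a i ≤ y i ∧ y i ≤ b i) ∧ w = ∑ i, y i • v i

/-- A Farkas matrix: an integral matrix whose columns are Farkas-related. -/
def Matrix.IsFarkas {κ ι : Type*} [Fintype ι] (A : Matrix κ ι ℤ) : Prop :=
  FarkasRelated fun j => A.col j

/-- The (unsigned) incidence matrix of `G`, with one row for each vertex and one column for each
edge. Mathlib's `SimpleGraph.incMatrix` also has a zero column for every non-edge. -/
def SimpleGraph.edgeIncMatrix {V : Type*} [DecidableEq V] (G : SimpleGraph V)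
    [DecidableRel G.Adj] :
    Matrix V G.edgeSet ℤ :=
  (G.incMatrix ℤ).submatrix id Subtype.val

/-- `G` contains two vertex-disjoint cycles `c`, `d` of odd length, and a path from a vertex of `c`
to a vertex of `d`. (A cycle may be based at any of its vertices, so it is no restriction to base
`c` and `d` at the two ends of the path.) -/
def SimpleGraph.HasPathConnectedOddCycles {V : Type*} (G : SimpleGraph V) : Prop :=
  ∃ (s t : V) (c : G.Walk s s) (d : G.Walk t t) (p : G.Walk s t),
    c.IsCycle ∧ Odd c.length ∧ d.IsCycle ∧ Odd d.length ∧
      c.support.Disjoint d.support ∧ p.IsPath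

/-! Write a combination of columns as a function on edges; its value at a vertex is the sum of the
function over the edges there (`vertexSum`). Around an odd closed walk, the alternating ±1 function
sums to 2 at the base and to 0 elsewhere.

Necessity (`HasPathConnectedOddCycles.not_isFarkas`): halves of two alternating odd cycles and an
alternating path combine to a rational solution with zero sums. Rounding it within its floors and
ceilings is impossible, by parity on the vertices of one cycle.

Sufficiency: moving a rational solution along kernel vectors supported on its fractional edges
leaves fewer of these. When no such vector remains, the fractional edges form disjoint odd cycles
(`exists_odd_cycle_of_vertexSum_injective`). If a component of `G` holds only one of them, a parity
count over the component makes its edges integral after all; so some component holds two. -/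

namespace SimpleGraph

variable {V : Type*} [DecidableEq V]

/-! ### Sums around vertices -/

section VertexSum

variable [Fintype V]

/-- The linear map that sums a function on unordered pairs over the pairs containing a vertex. -/
def vertexSum (R : Type*) [Semiring R] : (Sym2 V → R) →ₗ[R] V → R where
  toFun f v := ∑ e, if v ∈ e then f e else 0
  map_add' f g := by
    ext v
    simp only [Pi.add_apply, ← Finset.sum_add_distrib]
    refine Finset.sum_congr rfl fun e _ => ?_
    split_ifs <;> simp
  map_smul' c f := by
    ext v
    simp [Finset.mul_sum]

theorem vertexSum_apply {R : Type*} [Semiring R] (f : Sym2 V → R) (v : V) :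
    vertexSum R f v = ∑ e, if v ∈ e then f e else 0 := rfl

theorem vertexSum_intCast {R : Type*} [Ring R] (f : Sym2 V → ℤ) (v : V) :
    vertexSum R (fun e => (f e : R)) v = (vertexSum ℤ f v : ℤ) := by
  simp [vertexSum_apply, apply_ite (Int.cast : ℤ → R)]

theorem vertexSum_single {R : Type*} [Semiring R] {u v : V} (h : u ≠ v) :
    vertexSum R (Pi.single s(u, v) 1) = Pi.single u 1 + Pi.single v 1 := by
  ext w
  rw [vertexSum_apply, Finset.sum_eq_single s(u, v)]
  · by_cases h1 : w = u
    · subst h1; simp [h]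
    · by_cases h2 : w = v
      · subst h2; simp [h.symm]
      · simp [h1, h2]
  · intro e _ he
    simp [he]
  · simp

theorem vertexSum_eq_zero_of_forall {R : Type*} [Semiring R] {f : Sym2 V → R} {v : V}
    (h : ∀ e, v ∈ e → f e = 0) : vertexSum R f v = 0 := by
  rw [vertexSum_apply]
  exact Finset.sum_eq_zero fun e _ => by split_ifs with hv <;> simp [h e, *]

/-- If no pair of the support of `f` is a loop or leaves `S`, then summing `f` around the vertices
of `S` counts every value twice. -/
theorem even_sum_vertexSum {f : Sym2 V → ℤ} (S : Finset V)
    (h : ∀ u v, f s(u, v) ≠ 0 → u ≠ v ∧ (u ∈ S ↔ v ∈ S)) :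
    Even (∑ v ∈ S, vertexSum ℤ f v) := by
  simp only [vertexSum_apply]
  rw [Finset.sum_comm]
  refine Finset.even_sum _ fun e _ => ?_
  induction e with | h u v =>
  rw [← Finset.sum_filter, Finset.sum_const, nsmul_eq_mul]
  by_cases hf : f s(u, v) = 0
  · simp [hf]
  obtain ⟨huv, hS⟩ := h u v hf
  refine Even.mul_right ?_ _
  by_cases hu : u ∈ S
  · have : S.filter (· ∈ s(u, v)) = {u, v} := by
      ext w
      simp only [Finset.mem_filter, Sym2.mem_iff, Finset.mem_insert, Finset.mem_singleton]
      constructor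
      · exact fun h => h.2
      · rintro (rfl | rfl)
        · exact ⟨hu, Or.inl rfl⟩
        · exact ⟨hS.1 hu, Or.inr rfl⟩
    rw [this, Finset.card_pair huv]
    exact ⟨1, by norm_num⟩
  · have : S.filter (· ∈ s(u, v)) = ∅ := by
      ext w
      simp only [Finset.mem_filter, Sym2.mem_iff, Finset.notMem_empty, iff_false, not_and]
      rintro hw (rfl | rfl)
      · exact hu hw
      · exact hu (hS.2 hw)
    rw [this]
    simp

end VertexSum

/-! ### Alternating sums along walks -/

namespace Walk

variable {G : SimpleGraph V}

/-- The alternating sum of the edges of a walk, starting with a plus sign. -/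
def alternating : {u v : V} → G.Walk u v → Sym2 V → ℤ
  | _, _, nil => 0
  | u, _, cons (v := v) _ p => Pi.single s(u, v) 1 - p.alternating

/-- The contributions at inner vertices telescope. Hence a closed walk gives 0 if its length is
even, and 2 at its base if it is odd. -/
theorem vertexSum_alternating [Fintype V] {u v : V} (p : G.Walk u v) :
    vertexSum ℤ p.alternating = Pi.single u 1 - (-1 : ℤ) ^ p.length • Pi.single v 1 := by
  induction p with
  | nil => simp [alternating]
  | cons h p ih =>
    rw [alternating, map_sub, ih, vertexSum_single h.ne, length_cons, pow_succ]
    simp only [mul_neg, mul_one, neg_smul]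
    abel

theorem alternating_eq_zero {u v : V} (p : G.Walk u v) {e : Sym2 V} (he : e ∉ p.edges) :
    p.alternating e = 0 := by
  induction p with
  | nil => rfl
  | cons h p ih =>
    rw [edges_cons, List.mem_cons, not_or] at he
    simp [alternating, ih he.2, he.1]

theorem IsTrail.odd_alternating {u v : V} {p : G.Walk u v} (hp : p.IsTrail) {e : Sym2 V}
    (he : e ∈ p.edges) : Odd (p.alternating e) := by
  induction p with
  | nil => simp at he
  | @cons u w v h p ih =>
    rw [isTrail_cons] at hp
    rw [edges_cons, List.mem_cons] at he
    by_cases h' : e = s(u, w)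
    · subst h'
      simp [alternating, alternating_eq_zero p hp.2]
    · simp [alternating, h', ih hp.1 (he.resolve_left h')]

end Walk

/-! ### The Farkas property for functions on pairs -/

section Farkas

variable [Fintype V] (G : SimpleGraph V) [DecidableRel G.Adj]

theorem sum_mul_edgeIncMatrix {R : Type*} [Ring R] {f : Sym2 V → R}
    (hf : ∀ e ∉ G.edgeSet, f e = 0) (v : V) :
    ∑ e : G.edgeSet, f e * (G.edgeIncMatrix v e : R) = vertexSum R f v := by
  have key (e : G.edgeSet) :
      f e * (G.edgeIncMatrix v e : R) = if v ∈ (e : Sym2 V) then f e else 0 := by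
    simp [edgeIncMatrix, incMatrix_apply', incidenceSet]
  simp only [key, vertexSum_apply]
  rw [← Finset.sum_subset (Finset.subset_univ G.edgeFinset)]
  · exact (Finset.sum_subtype _ (fun e => by simp) (fun e => if v ∈ e then f e else 0)).symm
  · intro e _ he
    rw [mem_edgeFinset] at he
    simp [hf e he]

/-- The Farkas property of the incidence matrix in terms of functions on unordered pairs that
vanish outside the edges. -/
theorem isFarkas_edgeIncMatrix_iff :
    G.edgeIncMatrix.IsFarkas ↔ ∀ a b z : Sym2 V → ℤ, ∀ x : Sym2 V → ℚ,
      (∀ e ∉ G.edgeSet, z e = 0) → (∀ e ∉ G.edgeSet, x e = 0) →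
      (∀ e, (a e : ℚ) ≤ x e ∧ x e ≤ b e) →
      vertexSum ℚ x = vertexSum ℚ (fun e => (z e : ℚ)) →
      ∃ y : Sym2 V → ℤ, (∀ e ∉ G.edgeSet, y e = 0) ∧ (∀ e, a e ≤ y e ∧ y e ≤ b e) ∧
        vertexSum ℤ y = vertexSum ℤ z := by
  have ext_zero {R : Type} [Zero R] (f : G.edgeSet → R) :
      ∃ g : Sym2 V → R, (∀ e ∉ G.edgeSet, g e = 0) ∧ ∀ e : G.edgeSet, g e = f e :=
    ⟨Function.extend Subtype.val f 0, fun e he => Function.extend_apply' _ _ _ (by simpa using he),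
      fun e => Subtype.val_injective.extend_apply _ _ _⟩
  have comb {f : Sym2 V → ℤ} (hf : ∀ e ∉ G.edgeSet, f e = 0) :
      ∑ e : G.edgeSet, f e • G.edgeIncMatrix.col e = vertexSum ℤ f := by
    ext v
    simp [← G.sum_mul_edgeIncMatrix hf, Finset.sum_apply, Matrix.col]
  constructor
  · intro h a b z x hz hx hab hxz
    obtain ⟨y, hy, hyz⟩ := h (fun e => a e) (fun e => b e)
      (fun e => by exact_mod_cast (hab e).1.trans (hab e).2) (vertexSum ℤ z)
      (comb hz ▸ Submodule.sum_mem _ fun e _ =>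
        Submodule.smul_mem _ _ (Submodule.subset_span ⟨e, rfl⟩))
      ⟨fun e => x e, fun e => hab e, fun v => by
        rw [← vertexSum_intCast (R := ℚ), ← hxz, ← G.sum_mul_edgeIncMatrix hx]; rfl⟩
    obtain ⟨g, hg0, hg⟩ := ext_zero y
    refine ⟨g, hg0, fun e => ?_, ?_⟩
    · by_cases he : e ∈ G.edgeSet
      · simpa [← hg] using hy ⟨e, he⟩
      · have := hab e
        rw [hx e he] at this
        rw [hg0 e he]
        exact_mod_cast this
    · rw [hyz, ← comb hg0]
      simp [hg]
  · rintro h a b - w hw ⟨x, hab, hxw⟩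
    obtain ⟨c, rfl⟩ := (Submodule.mem_span_range_iff_exists_fun ℤ).1 hw
    obtain ⟨a', ha0, ha⟩ := ext_zero a
    obtain ⟨b', hb0, hb⟩ := ext_zero b
    obtain ⟨z, hz0, hz⟩ := ext_zero c
    obtain ⟨x', hx0, hx⟩ := ext_zero x
    have hc : ∑ e, c e • G.edgeIncMatrix.col e = vertexSum ℤ z := by
      rw [← comb hz0]; simp [hz]
    obtain ⟨y, hy0, hy, hyz⟩ := h a' b' z x' hz0 hx0 (fun e => by
      by_cases he : e ∈ G.edgeSet
      · simpa [← ha, ← hb, ← hx] using hab ⟨e, he⟩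
      · simp [ha0 e he, hb0 e he, hx0 e he]) (by
      ext v
      rw [vertexSum_intCast, ← hc, hxw v, ← G.sum_mul_edgeIncMatrix hx0]
      simp [hx, Matrix.col])
    refine ⟨fun e => y e, fun e => by simpa [ha, hb] using hy e, ?_⟩
    rw [hc, ← hyz, ← comb hy0]

end Farkas

/-! ### Necessity: the parity obstruction -/

theorem Walk.vertexSum_alternating_cast [Fintype V] {G : SimpleGraph V} {u v : V}
    (p : G.Walk u v) :
    vertexSum ℚ (fun e => (p.alternating e : ℚ)) =
      Pi.single u 1 - (-1 : ℚ) ^ p.length • Pi.single v 1 := by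
  ext w
  rw [vertexSum_intCast, p.vertexSum_alternating]
  simp [Pi.single_apply]

theorem HasPathConnectedOddCycles.not_isFarkas [Fintype V] {G : SimpleGraph V}
    [DecidableRel G.Adj] (hG : G.HasPathConnectedOddCycles) : ¬ G.edgeIncMatrix.IsFarkas := by
  obtain ⟨s, t, c, d, p, -, hc, -, hd, hcd, -⟩ := hG
  rw [isFarkas_edgeIncMatrix_iff]
  intro h
  -- The half cycles contribute 1 at `s` and `-(-1) ^ p.length` at `t`, which the path cancels.
  let x : Sym2 V → ℚ := (1 / 2 : ℚ) • (fun e => (c.alternating e : ℚ)) -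
    (fun e => (p.alternating e : ℚ)) -
    ((-1) ^ p.length / 2 : ℚ) • (fun e => (d.alternating e : ℚ))
  have hx (e : Sym2 V) : x e = 1 / 2 * c.alternating e - p.alternating e -
    (-1) ^ p.length / 2 * d.alternating e := rfl
  have edge {u v : V} (q : G.Walk u v) {e : Sym2 V} (he : e ∉ G.edgeSet) :
      q.alternating e = 0 :=
    q.alternating_eq_zero fun h => he (q.edges_subset_edgeSet h)
  obtain ⟨y, hy0, hy, hyz⟩ := h (fun e => ⌊x e⌋) (fun e => ⌈x e⌉) 0 x (by simp)
    (fun e he => by simp [hx, edge _ he]) (fun e => ⟨Int.floor_le _, Int.le_ceil _⟩) (by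
      simp only [x, map_sub, map_smul, Walk.vertexSum_alternating_cast, hc.neg_one_pow,
        hd.neg_one_pow]
      ext v
      rw [vertexSum_intCast]
      simp only [map_zero, Pi.sub_apply, Pi.smul_apply, smul_eq_mul, Pi.zero_apply, Int.cast_zero,
        Pi.single_apply]
      ring)
  -- On an edge leaving the first cycle only the path contributes, so `x` is integral there and
  -- floor and ceiling determine `y`.
  have hcross {u v : V} (hu : u ∈ c.support) (hv : v ∉ c.support) :
      y s(u, v) + p.alternating s(u, v) = 0 := by
    have h1 : c.alternating s(u, v) = 0 :=
      c.alternating_eq_zero fun h => hv (c.snd_mem_support_of_mem_edges h)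
    have h2 : d.alternating s(u, v) = 0 :=
      d.alternating_eq_zero fun h => hcd hu (d.fst_mem_support_of_mem_edges h)
    have h3 : x s(u, v) = ((-p.alternating s(u, v) : ℤ) : ℚ) := by simp [hx, h1, h2]
    have h4 := hy s(u, v)
    simp only [h3, Int.floor_intCast, Int.ceil_intCast] at h4
    omega
  have heven := even_sum_vertexSum (f := y + p.alternating) c.support.toFinset (by
    intro u v huv
    constructor
    · rintro rfl
      have : s(u, u) ∉ G.edgeSet := by simp
      exact huv (by simp [hy0 _ this, edge _ this])
    · simp only [List.mem_toFinset]
      by_contra hiff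
      by_cases hu : u ∈ c.support
      · exact huv (hcross hu (by tauto))
      · refine huv ?_
        rw [Sym2.eq_swap]
        exact hcross (by tauto) hu)
  have ht : t ∉ c.support := fun ht => hcd ht d.start_mem_support
  -- The sum over the first cycle is 1: it contains `s` but not `t`.
  simp only [map_add, hyz, map_zero, zero_add, p.vertexSum_alternating, Pi.sub_apply,
    Finset.sum_sub_distrib, Pi.smul_apply, ← Finset.smul_sum] at heven
  simp [ht] at heven

/-! ### Reducing the number of fractional coordinates -/

/-- A point can be moved along a nonzero direction supported on its fractional coordinates, without
crossing integers, until a fractional coordinate becomes an integer. -/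
theorem exists_fract_add_mul_eq_zero {ι : Type*} [Fintype ι] {x k : ι → ℚ} (hk : k ≠ 0)
    (h : ∀ i, Int.fract (x i) = 0 → k i = 0) :
    ∃ t : ℚ, (∀ i, (⌊x i⌋ : ℚ) ≤ x i + t * k i ∧ x i + t * k i ≤ ⌈x i⌉) ∧
      ∃ i, Int.fract (x i) ≠ 0 ∧ Int.fract (x i + t * k i) = 0 := by
  -- The time at which coordinate `i` reaches the next integer in its direction of motion; the
  -- minimum is taken over moving coordinates only.
  let τ (i : ι) : ℚ := if 0 < k i then (⌈x i⌉ - x i) / k i else (x i - ⌊x i⌋) / (-k i)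
  obtain ⟨j, hj⟩ := Function.ne_iff.1 hk
  obtain ⟨i, hi, hmin⟩ := (Finset.univ.filter (k · ≠ 0)).exists_min_image τ ⟨j, by simpa using hj⟩
  rw [Finset.mem_filter] at hi
  have hτ (l : ι) : 0 ≤ τ l := by
    have h1 := Int.floor_le (x l)
    have h2 := Int.le_ceil (x l)
    by_cases hl : 0 < k l
    · simp only [τ, hl, if_true]
      exact div_nonneg (by linarith) hl.le
    · simp only [τ, hl, if_false]
      exact div_nonneg (by linarith) (by linarith)
  refine ⟨τ i, fun l => ?_, i, fun h0 => hi.2 (h i h0), ?_⟩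
  · have h1 := Int.floor_le (x l)
    have h2 := Int.le_ceil (x l)
    rcases lt_trichotomy (k l) 0 with hl | hl | hl
    · have := hmin l (by simp [hl.ne])
      have h3 : τ i * (-k l) ≤ x l - ⌊x l⌋ := by
        rw [← le_div_iff₀ (by linarith)]
        simpa [τ, hl.not_gt] using this
      have h4 := mul_nonneg (hτ i) (neg_nonneg.2 hl.le)
      constructor <;> linarith
    · simp [hl, h1, h2]
    · have := hmin l (by simp [hl.ne'])
      have h3 : τ i * k l ≤ ⌈x l⌉ - x l := by
        rw [← le_div_iff₀ hl]
        simpa [τ, hl] using this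
      have h4 := mul_nonneg (hτ i) hl.le
      constructor <;> linarith
  · rw [Int.fract_eq_zero_iff]
    have hi' := hi.2
    by_cases hl : 0 < k i
    · exact ⟨⌈x i⌉, by simp only [τ, hl, if_true]; field_simp; ring⟩
    · exact ⟨⌊x i⌋, by simp only [τ, hl, if_false]; field_simp; ring⟩

/-! ### Graphs on which vertex sums determine the function -/

section Kernel

variable [Fintype V] {F : SimpleGraph V}

/-- Vertex sums embed the edge space into the vertex space; compare dimensions. -/
theorem card_edgeSet_le_card_support
    (hF : ∀ k : Sym2 V → ℚ, (∀ e ∉ F.edgeSet, k e = 0) → vertexSum ℚ k = 0 → k = 0) :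
    Nat.card F.edgeSet ≤ Nat.card F.support := by
  classical
  let L : (F.edgeSet → ℚ) →ₗ[ℚ] (F.support → ℚ) :=
    LinearMap.funLeft ℚ ℚ Subtype.val ∘ₗ vertexSum ℚ ∘ₗ
      Function.ExtendByZero.linearMap ℚ Subtype.val
  have hL : Function.Injective L := by
    rw [← LinearMap.ker_eq_bot, LinearMap.ker_eq_bot']
    intro f hf
    have h0 : ∀ e ∉ F.edgeSet, Function.extend Subtype.val f 0 e = 0 := fun e he =>
      Function.extend_apply' _ _ _ (by simpa using he)
    have := hF (Function.extend Subtype.val f 0) h0 (by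
      ext v
      by_cases hv : v ∈ F.support
      · exact congrFun hf ⟨v, hv⟩
      · refine vertexSum_eq_zero_of_forall fun e he => h0 e fun heF => hv ?_
        obtain ⟨w, rfl⟩ := he
        exact ⟨w, heF⟩)
    ext e
    rw [← Subtype.val_injective.extend_apply f 0 e, this]
    rfl
  simpa using LinearMap.finrank_le_finrank_of_injective hL

/-- Degrees are at least 2 on the support, but they add up to twice the number of edges, hence to at
most twice the number of support vertices. So each equals 2. -/
theorem isCycles_of_vertexSum_injective
    (hF : ∀ k : Sym2 V → ℚ, (∀ e ∉ F.edgeSet, k e = 0) → vertexSum ℚ k = 0 → k = 0)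
    (hleaf : ∀ v u, F.Adj v u → ∃ w, w ≠ u ∧ F.Adj v w) : F.IsCycles := by
  classical
  have hdeg (v : V) (hv : v ∈ F.support) : 2 ≤ F.degree v := by
    obtain ⟨u, hu⟩ := hv
    obtain ⟨w, hwu, hw⟩ := hleaf v u hu
    rw [← card_neighborFinset_eq_degree]
    exact Finset.one_lt_card.2 ⟨w, by simpa using hw, u, by simpa using hu, hwu⟩
  have hcard : F.edgeFinset.card ≤ F.support.toFinset.card := by
    simpa [Nat.card_eq_fintype_card, edgeFinset, Set.toFinset_card] using
      card_edgeSet_le_card_support hF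
  have hsum : ∑ v ∈ F.support.toFinset, F.degree v = 2 * F.edgeFinset.card := by
    rw [← sum_degrees_eq_twice_card_edges]
    refine Finset.sum_subset (Finset.subset_univ _) fun v _ hv => ?_
    by_contra hne
    obtain ⟨w, hw⟩ := (F.degree_pos_iff_exists_adj v).1 (Nat.pos_of_ne_zero hne)
    exact hv (by simpa using ⟨w, hw⟩)
  have heq := (Finset.sum_eq_sum_iff_of_le (s := F.support.toFinset) (f := fun _ => 2)
    (g := fun v => F.degree v) (fun v hv => hdeg v (by simpa using hv))).1 (by
      refine le_antisymm (Finset.sum_le_sum fun v hv => hdeg v (by simpa using hv)) ?_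
      rw [hsum, Finset.sum_const, smul_eq_mul]
      omega)
  rintro v ⟨u, hu⟩
  rw [Set.ncard_eq_toFinset_card', ← neighborFinset_def, card_neighborFinset_eq_degree]
  exact (heq v (by simpa using ⟨u, hu⟩)).symm

/-- The component of `v` is a cycle. Were it even, its alternating function would be a nonzero
kernel vector. -/
theorem exists_odd_cycle_of_vertexSum_injective
    (hF : ∀ k : Sym2 V → ℚ, (∀ e ∉ F.edgeSet, k e = 0) → vertexSum ℚ k = 0 → k = 0)
    (hleaf : ∀ v u, F.Adj v u → ∃ w, w ≠ u ∧ F.Adj v w) {v : V} (hv : v ∈ F.support) :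
    ∃ c : F.Walk v v, c.IsCycle ∧ Odd c.length ∧ (∀ w, w ∈ c.support ↔ F.Reachable v w) ∧
      ∀ u w, u ∈ c.support → F.Adj u w → s(u, w) ∈ c.edges := by
  classical
  have hcyc := isCycles_of_vertexSum_injective hF hleaf
  obtain ⟨c, hc, hcv⟩ := hcyc.exists_cycle_toSubgraph_verts_eq_connectedComponentSupp
    (c := F.connectedComponentMk v) rfl hv
  refine ⟨c, hc, ?_, fun w => ?_, fun u w hu huw => ?_⟩
  · by_contra heven
    rw [Nat.not_odd_iff_even] at heven
    have h0 := hF (fun e => (c.alternating e : ℚ))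
      (fun e he => by
        simpa using c.alternating_eq_zero fun h => he (c.edges_subset_edgeSet h))
      (by simp [c.vertexSum_alternating_cast, heven.neg_one_pow])
    obtain ⟨e, he⟩ := List.exists_mem_of_ne_nil c.edges (by simpa using hc.ne_nil)
    have h1 := hc.isTrail.odd_alternating he
    have h2 := congrFun h0 e
    simp only [Pi.zero_apply, Int.cast_eq_zero] at h2
    simp [h2] at h1
  · rw [← Walk.mem_verts_toSubgraph, hcv, ConnectedComponent.mem_supp_iff, ConnectedComponent.eq,
      reachable_comm]
  · rw [← Walk.adj_toSubgraph_iff_mem_edges]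
    exact (hc.adj_toSubgraph_iff_of_isCycles hcyc (by simpa using hu) w).2 huw

end Kernel

/-! ### Sufficiency: the graph of fractional edges -/

variable [Fintype V]

/-- If a rational vector agrees with an integral one after summing around vertices, then no vertex
is an end of exactly one edge of fractional value. -/
theorem exists_ne_fract_ne_zero {x : Sym2 V → ℚ} {z : Sym2 V → ℤ}
    (hxz : vertexSum ℚ x = vertexSum ℚ (fun e => (z e : ℚ))) {v u : V}
    (hu : Int.fract (x s(v, u)) ≠ 0) : ∃ w, w ≠ u ∧ Int.fract (x s(v, w)) ≠ 0 := by
  by_contra! hall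
  refine hu (Int.fract_eq_zero_iff.2 ?_)
  have hv := congrFun hxz v
  rw [vertexSum_intCast, vertexSum_apply, ← Finset.add_sum_erase _ _ (Finset.mem_univ s(v, u)),
    if_pos (Sym2.mem_mk_left v u)] at hv
  have hmem : ∑ e ∈ Finset.univ.erase s(v, u), (if v ∈ e then x e else 0) ∈
      (Int.castAddHom ℚ).range := by
    refine AddSubgroup.sum_mem _ fun e he => ?_
    split_ifs with hve
    · obtain ⟨w, rfl⟩ := hve
      have hwu : w ≠ u := by
        rintro rfl
        simp at he
      exact Int.fract_eq_zero_iff.1 (hall w hwu)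
    · exact zero_mem _
  obtain ⟨n, hn⟩ := hmem
  refine ⟨vertexSum ℤ z v - n, ?_⟩
  rw [← hn] at hv
  simp only [Int.coe_castAddHom] at hv
  push_cast
  linarith

/-- If `x` is fractional somewhere and is the only vector with its vertex sums that differs from it
only at fractional edges, then `G` has two disjoint odd cycles connected by a path. -/
theorem hasPathConnectedOddCycles_of_fract_ne_zero {G : SimpleGraph V} {x : Sym2 V → ℚ}
    {z : Sym2 V → ℤ} (hx : ∀ e ∉ G.edgeSet, x e = 0) (hz : ∀ e ∉ G.edgeSet, z e = 0)
    (hxz : vertexSum ℚ x = vertexSum ℚ (fun e => (z e : ℚ)))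
    (hker : ∀ k : Sym2 V → ℚ, (∀ e, Int.fract (x e) = 0 → k e = 0) → vertexSum ℚ k = 0 → k = 0)
    (hfrac : ∃ e, Int.fract (x e) ≠ 0) : G.HasPathConnectedOddCycles := by
  classical
  have hadj {u v : V} (h : Int.fract (x s(u, v)) ≠ 0) : G.Adj u v := by
    by_contra hG
    simp [hx s(u, v) hG] at h
  let F : SimpleGraph V :=
    { Adj := fun u v => Int.fract (x s(u, v)) ≠ 0
      symm := ⟨fun u v h => by rwa [Sym2.eq_swap]⟩
      loopless := ⟨fun u h => (hadj h).ne rfl⟩ }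
  have hFG : F ≤ G := fun u v h => hadj h
  have hFe (e : Sym2 V) : e ∈ F.edgeSet ↔ Int.fract (x e) ≠ 0 := by
    induction e with | h u v => exact Iff.rfl
  have hFker (k : Sym2 V → ℚ) (hk : ∀ e ∉ F.edgeSet, k e = 0) (h0 : vertexSum ℚ k = 0) : k = 0 :=
    hker k (fun e he => hk e (by simp [hFe, he])) h0
  have hleaf (v u : V) (h : F.Adj v u) : ∃ w, w ≠ u ∧ F.Adj v w := exists_ne_fract_ne_zero hxz h
  obtain ⟨e₀, he₀⟩ := hfrac
  induction e₀ with | h s r =>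
  obtain ⟨c, hc, hcodd, hcs, hce⟩ :=
    exists_odd_cycle_of_vertexSum_injective hFker hleaf (v := s) ⟨r, he₀⟩
  have hsc : s(s, r) ∈ c.edges := hce s r c.start_mem_support he₀
  by_contra hno
  -- A fractional cycle elsewhere in the component of `s` in `G` would be disjoint from `c` and
  -- joined to it by a path.
  have hK (v : V) (hv : v ∈ F.support) (hsv : G.Reachable s v) : v ∈ c.support := by
    by_contra hvc
    obtain ⟨d, hd, hdodd, hds, -⟩ := exists_odd_cycle_of_vertexSum_injective hFker hleaf hv
    obtain ⟨p, hp⟩ := hsv.exists_isPath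
    refine hno ⟨s, v, c.mapLe hFG, d.mapLe hFG, p, hc.mapLe hFG, by simpa using hcodd,
      hd.mapLe hFG, by simpa using hdodd, ?_, hp⟩
    intro w hwc hwd
    simp only [Walk.support_mapLe_eq_support] at hwc hwd
    exact hvc ((hcs v).2 (((hcs w).1 hwc).trans ((hds w).1 hwd).symm))
  let K : Finset V := Finset.univ.filter (G.Reachable s)
  have hcK : c.support.toFinset ⊆ K := by
    intro v hv
    simpa [K] using ((hcs v).1 (by simpa using hv)).mono hFG
  let xc (e : Sym2 V) : ℚ := if e ∈ c.edges then x e else 0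
  -- Within `K` every edge off `c` is integral, so there `xc - y` is `x - z`, whose vertex sums
  -- vanish.
  let y (e : Sym2 V) : ℤ := z e - if e ∈ c.edges then 0 else ⌊x e⌋
  have hxy (v : V) (hv : v ∈ K) : vertexSum ℚ xc v = vertexSum ℤ y v := by
    rw [← vertexSum_intCast, ← sub_eq_zero, ← Pi.sub_apply, ← map_sub]
    have hz' : vertexSum ℚ (x - fun e => (z e : ℚ)) v = 0 := by
      rw [map_sub, hxz, sub_self, Pi.zero_apply]
    rw [← hz']
    simp only [vertexSum_apply]
    refine Finset.sum_congr rfl fun e _ => ?_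
    split_ifs with hve
    · simp only [xc, y, Pi.sub_apply]
      split_ifs with he
      · simp
      · have hfl : x e = ⌊x e⌋ := by
          rw [eq_comm, Int.floor_eq_self_iff_mem, ← Int.fract_eq_zero_iff]
          by_contra hne
          obtain ⟨w, rfl⟩ := hve
          exact he (hce v w (hK v ⟨w, hne⟩ (by simpa [K] using hv)) hne)
        push_cast
        rw [← hfl]
        ring
    · rfl
  have heven : Even (∑ v ∈ K, vertexSum ℤ y v) := by
    refine even_sum_vertexSum K fun u v huv => ?_
    have hG : G.Adj u v := by
      by_contra hG
      have hc' : s(u, v) ∉ c.edges := fun h => hG (hFG (c.edges_subset_edgeSet h))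
      simp [y, hc', hz s(u, v) hG, hx s(u, v) hG] at huv
    refine ⟨hG.ne, ?_⟩
    simp only [K, Finset.mem_filter, Finset.mem_univ, true_and]
    exact ⟨fun h => h.trans hG.reachable, fun h => h.trans hG.symm.reachable⟩
  have hxc0 (v : V) (hv : v ∉ c.support) : vertexSum ℚ xc v = 0 := by
    refine vertexSum_eq_zero_of_forall fun e hve => if_neg fun he => hv ?_
    exact c.mem_support_of_mem_edges he hve
  rw [← Finset.sum_subset hcK fun v hv hvc => by
    exact_mod_cast (hxy v hv).symm.trans (hxc0 v (by simpa using hvc))] at heven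
  -- Basing the odd cycle at `v` gives an integral function with sum 2 at `v` alone, odd on every
  -- edge of `c`.
  have hrot (v : V) : ∃ h : Sym2 V → ℤ, v ∈ c.support → vertexSum ℤ h = Pi.single v 2 ∧
      (∀ e ∉ c.edges, h e = 0) ∧ ∀ e ∈ c.edges, Odd (h e) := by
    by_cases hv : v ∈ c.support
    · refine ⟨(c.rotate v hv).alternating, fun _ => ⟨?_, fun e he => ?_, fun e he => ?_⟩⟩
      · rw [Walk.vertexSum_alternating, Walk.length_rotate, hcodd.neg_one_pow]
        ext w
        by_cases hw : w = v
        · subst hw; simp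
        · simp [hw]
      · exact Walk.alternating_eq_zero _ (by rwa [(c.rotate_edges v hv).mem_iff])
      · exact (hc.rotate hv).isTrail.odd_alternating (by rwa [(c.rotate_edges v hv).mem_iff])
    · exact ⟨0, fun h => absurd h hv⟩
  choose h hh using hrot
  -- Both sides live on fractional edges and have equal vertex sums, so injectivity identifies them.
  have hxh : xc = ∑ v ∈ c.support.toFinset,
      ((vertexSum ℤ y v : ℚ) / 2) • fun e => (h v e : ℚ) := by
    rw [← sub_eq_zero]
    refine hFker _ (fun e he => ?_) ?_
    · have he' : e ∉ c.edges := fun h => he (c.edges_subset_edgeSet h)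
      simp only [Pi.sub_apply, Finset.sum_apply, Pi.smul_apply, xc, if_neg he', zero_sub,
        neg_eq_zero]
      exact Finset.sum_eq_zero fun v hv => by simp [(hh v (by simpa using hv)).2.1 e he']
    · ext w
      rw [map_sub, map_sum, Pi.sub_apply, Pi.zero_apply, sub_eq_zero, Finset.sum_apply]
      have hterm : ∀ v ∈ c.support.toFinset,
          vertexSum ℚ (((vertexSum ℤ y v : ℚ) / 2) • fun e => (h v e : ℚ)) w =
            if w = v then (vertexSum ℤ y v : ℚ) else 0 := by
        intro v hv
        rw [map_smul, Pi.smul_apply, vertexSum_intCast, (hh v (by simpa using hv)).1]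
        by_cases hw : w = v
        · subst hw; simp
        · simp [hw]
      rw [Finset.sum_congr rfl hterm, Finset.sum_ite_eq]
      split_ifs with hw
      · exact hxy w (hcK hw)
      · exact hxc0 w (by simpa using hw)
  -- As the `h v` are odd on `c`, this has the parity of the sum of the vertex sums of `y`. Half of
  -- it is `x s(s, r)`, which is therefore an integer.
  have hsum : Even (∑ v ∈ c.support.toFinset, vertexSum ℤ y v * h v s(s, r)) := by
    have hdiff : Even (∑ v ∈ c.support.toFinset, vertexSum ℤ y v * (h v s(s, r) - 1)) :=
      Finset.even_sum _ fun v hv =>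
        (((hh v (by simpa using hv)).2.2 _ hsc).sub_odd odd_one).mul_left _
    simpa [mul_sub] using hdiff.add heven
  obtain ⟨n, hn⟩ := hsum
  refine he₀ (Int.fract_eq_zero_iff.2 ⟨n, ?_⟩)
  have hx₀ := congrFun hxh s(s, r)
  simp only [xc, if_pos hsc, Finset.sum_apply, Pi.smul_apply, smul_eq_mul] at hx₀
  have hn' := congrArg (Int.cast : ℤ → ℚ) hn
  push_cast at hn'
  rw [hx₀, ← mul_right_inj' (two_ne_zero' ℚ), Finset.mul_sum, two_mul, ← hn']
  exact Finset.sum_congr rfl fun v _ => by ring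

/-- Induction on the number of fractional edges: without the forbidden configuration a kernel vector
supported on them exists. Moving along it respects the bounds, since these are integers. -/
theorem isFarkas_of_not_hasPathConnectedOddCycles (G : SimpleGraph V) [DecidableRel G.Adj]
    (hG : ¬ G.HasPathConnectedOddCycles) : G.edgeIncMatrix.IsFarkas := by
  rw [isFarkas_edgeIncMatrix_iff]
  intro a b z x hz hx hab hxz
  induction hn : (Finset.univ.filter fun e => Int.fract (x e) ≠ 0).card using
    Nat.strong_induction_on generalizing x with
  | _ n ih =>
  by_cases hfrac : ∃ e, Int.fract (x e) ≠ 0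
  · have hker := mt (fun hker => hasPathConnectedOddCycles_of_fract_ne_zero hx hz hxz hker hfrac) hG
    push Not at hker
    obtain ⟨k, hk, hk0, hne⟩ := hker
    obtain ⟨t, ht, i, hi, hi'⟩ := exists_fract_add_mul_eq_zero hne hk
    refine ih _ ?_ (x + t • k) (fun e he => ?_) (fun e => ?_) ?_ rfl
    · rw [← hn]
      refine Finset.card_lt_card ⟨fun e he => ?_, fun hsub => ?_⟩
      · rw [Finset.mem_filter] at he ⊢
        refine ⟨he.1, fun h0 => he.2 ?_⟩
        simp [hk e h0, h0]
      · have := hsub (Finset.mem_filter.2 ⟨Finset.mem_univ i, hi⟩)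
        exact (Finset.mem_filter.1 this).2 hi'
    · have := hx e he
      simp [this, hk e (by simp [this])]
    · exact ⟨le_trans (by exact_mod_cast Int.le_floor.2 (hab e).1) (ht e).1,
        (ht e).2.trans (by exact_mod_cast Int.ceil_le.2 (hab e).2)⟩
    · rw [map_add, map_smul, hk0, smul_zero, add_zero, hxz]
  · push Not at hfrac
    have hfl (e : Sym2 V) : (⌊x e⌋ : ℚ) = x e := by
      rw [Int.floor_eq_self_iff_mem, ← Int.fract_eq_zero_iff]
      exact hfrac e
    refine ⟨fun e => ⌊x e⌋, fun e he => by simp [hx e he], fun e => ?_, ?_⟩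
    · have := hab e
      rw [← hfl e] at this
      exact_mod_cast this
    · ext v
      have := congrFun hxz v
      rw [vertexSum_intCast, ← funext hfl, vertexSum_intCast] at this
      exact_mod_cast this

end SimpleGraph

theorem proposition4p2 {V : Type*} [Fintype V] [DecidableEq V] (G : SimpleGraph V)
    [DecidableRel G.Adj] :
    G.edgeIncMatrix.IsFarkas ↔ ¬ G.HasPathConnectedOddCycles :=
  ⟨fun h hG => hG.not_isFarkas h, G.isFarkas_of_not_hasPathConnectedOddCycles⟩
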